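/- Let $N,n,m\in\mathbb N$ and $\mathcal I=\{1,\dots,N\}$. Let $A\in\mathbb R^{n\times n}$ be invertible and, for $i\in\mathcal I$, let $B_i\in\mathbb R^{n\times m}$, $Q_i=C_i^\top C_i\in\mathbb R^{n\times n}$ and $R_i=R_i^\top\succ0$ in $\mathbb R^{m\times m}$, with $(A,B_i)$ stabilizable and $(A,C_i)$ detectable. A square matrix is called Schur if all its eigenvalues have modulus smaller than $1$. Put $S_i=B_iR_i^{-1}B_i^\top$ and $$H=\begin{bmatrix}A+\sum_{j\in\mathcal I}S_jA^{-\top}Q_j & [-S_1A^{-\top},\dots,-S_NA^{-\top}]\\ \operatorname{col}(-A^{-\top}Q_j)_{j\in\mathcal I} & I_N\otimes A^{-\top}\end{bmatrix}\in\mathbb R^{(1+N)n\times(1+N)n}.$$ Assume that $H$ has exactly $n$ eigenvalues (with multiplicity) of modulus smaller than $1$, and that an $n$-dimensional invariant subspace $V$ of $H$, on which $H$ has only eigenvalues of modulus smaller than $1$, is complementary to $\operatorname{Im}\begin{bmatrix}0\\ I_{Nn}\end{bmatrix}$. Let $(P_i^{\rm OL},K_i^{\rm OL})_{i\in\mathcal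 I}$ be the solution associated with $V$ of the coupled open-loop Riccati equations, that is, $$P_i^{\rm OL}=Q_i+A^\top P_i^{\rm OL}\bar A^{\rm OL},\qquad K_i^{\rm OL}=-R_i^{-1}B_i^\top P_i^{\rm OL}\bar A^{\rm OL}\quad(i\in\mathcal I),\qquad \bar A^{\rm OL}:=A+\sum_{j\in\mathcal I}B_jK_j^{\rm OL},$$ and $V=\operatorname{Im}\,\operatorname{col}(I_n,P_1^{\rm OL},\dots,P_N^{\rm OL})$. For each $i$ let $(P_i^{\rm LQR},K_i^{\rm LQR})$ be the solution of the standard LQR problem for $(A,B_i)$ with weights $Q_i,R_i$, that is, $P_i^{\rm LQR}\succeq0$ and $$P_i^{\rm LQR}=Q_i+A^\top P_i^{\rm LQR}(A+B_iK_i^{\rm LQR}),\qquad K_i^{\rm LQR}=-R_i^{-1}B_i^\top P_i^{\rm LQR}(A+B_iK_i^{\rm LQR}).$$ For each $i\in\mathcal I$ define $$\widehat A_i=\begin{bmatrix}A&\sum_{j\ne i}B_jK_j^{\rm OL}\\0&\bar A^{\rm OL}\end{bmatrix},\quad \widehat B_i=\begin{bmatrix}B_i\\0\end{bmatrix},\quad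 \widehat Q_i=\begin{bmatrix}Q_i&0\\0&0\end{bmatrix},\quad \widehat R_i=R_i.$$ Then, for every $i\in\mathcal I$, the algebraic Riccati equation $$\widehat P_i=\widehat Q_i+\widehat A_i^\top\widehat P_i(\widehat A_i+\widehat B_i\widehat K_i),\qquad \widehat K_i=-(\widehat R_i+\widehat B_i^\top\widehat P_i\widehat B_i)^{-1}\widehat B_i^\top\widehat P_i\widehat A_i$$ has a unique solution $(\widehat P_i,\widehat K_i)$ with $\widehat P_i$ (symmetric) positive semidefinite; it has the form $$\widehat P_i=\begin{bmatrix}P_i^{\rm LQR}&P_i^{\rm OL}-P_i^{\rm LQR}\\(P_i^{\rm OL}-P_i^{\rm LQR})^\top&*\end{bmatrix},\qquad \widehat K_i=\begin{bmatrix}K_i^{\rm LQR}&K_i^{\rm OL}-K_i^{\rm LQR}\end{bmatrix},$$ and $\widehat A_i+\widehat B_i\widehat K_i$ is Schur. -/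

import Mathlib

open Matrix
open scoped Kronecker

noncomputable section

/-- A real square matrix is Schur (discrete-time stable) if all its complex eigenvalues have
modulus smaller than `1`. -/
def IsSchur {κ : Type*} [Fintype κ] [DecidableEq κ] (M : Matrix κ κ ℝ) : Prop :=
  ∀ z ∈ (M.map (algebraMap ℝ ℂ)).charpoly.roots, ‖z‖ < 1

/-- `(A, B)` is stabilizable: some state feedback `K` makes `A + B K` Schur. -/
def IsStabilizable {n m : ℕ} (A : Matrix (Fin n) (Fin n) ℝ) (B : Matrix (Fin n) (Fin m) ℝ) :
    Prop :=
  ∃ K : Matrix (Fin m) (Fin n) ℝ, IsSchur (A + B * K)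

/-- `(A, C)` is detectable: some output injection `L` makes `A + L C` Schur. -/
def IsDetectable {n p : ℕ} (A : Matrix (Fin n) (Fin n) ℝ) (C : Matrix (Fin p) (Fin n) ℝ) :
    Prop :=
  ∃ L : Matrix (Fin n) (Fin p) ℝ, IsSchur (A + L * C)

/-- The number of complex eigenvalues of modulus smaller than `1` of a real square matrix,
counted with algebraic multiplicity. -/
def numStableEigenvalues {κ : Type*} [Fintype κ] [DecidableEq κ] (M : Matrix κ κ ℝ) : ℕ :=
  open Classical in (M.map (algebraMap ℝ ℂ)).charpoly.roots.countP (fun z => ‖z‖ < 1)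

/-- `V` is a stable invariant subspace of `M`: it is `M`-invariant and all (complex) eigenvalues
of the restriction of `M` to `V` have modulus smaller than `1`. -/
def IsStableInvariantSubspace {κ : Type*} [Fintype κ] [DecidableEq κ] (M : Matrix κ κ ℝ)
    (V : Submodule ℝ (κ → ℝ)) : Prop :=
  ∃ hV : ∀ x ∈ V, M.mulVecLin x ∈ V,
    ∀ z ∈ ((M.mulVecLin.restrict hV).charpoly.map (algebraMap ℝ ℂ)).roots, ‖z‖ < 1

/-- The closed-loop matrix `A + ∑ i, B i * K i`. -/
def closedLoop {N n m : ℕ} (A : Matrix (Fin n) (Fin n) ℝ)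
    (B : Fin N → Matrix (Fin n) (Fin m) ℝ) (K : Fin N → Matrix (Fin m) (Fin n) ℝ) :
    Matrix (Fin n) (Fin n) ℝ :=
  A + ∑ i, B i * K i

/-- `(P i, K i)` solves the coupled open-loop Riccati equations. -/
def SolvesOpenLoopRiccati {N n m : ℕ} (A : Matrix (Fin n) (Fin n) ℝ)
    (B : Fin N → Matrix (Fin n) (Fin m) ℝ) (Q : Fin N → Matrix (Fin n) (Fin n) ℝ)
    (R : Fin N → Matrix (Fin m) (Fin m) ℝ) (P : Fin N → Matrix (Fin n) (Fin n) ℝ)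
    (K : Fin N → Matrix (Fin m) (Fin n) ℝ) : Prop :=
  ∀ i, P i = Q i + Aᵀ * P i * closedLoop A B K ∧
    K i = -((R i)⁻¹ * (B i)ᵀ * P i * closedLoop A B K)

/-- `S = B R⁻¹ Bᵀ`. -/
def inputWeight {n m : ℕ} (B : Matrix (Fin n) (Fin m) ℝ) (R : Matrix (Fin m) (Fin m) ℝ) :
    Matrix (Fin n) (Fin n) ℝ :=
  B * R⁻¹ * Bᵀ

/-- The matrix `H` of the open-loop game, of size `(1 + N) n`:
`H = [[A + ∑ⱼ Sⱼ A⁻ᵀ Qⱼ, row(-Sⱼ A⁻ᵀ)], [col(-A⁻ᵀ Qⱼ), I_N ⊗ A⁻ᵀ]]`. -/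
def openLoopMatrix {N n m : ℕ} (A : Matrix (Fin n) (Fin n) ℝ)
    (B : Fin N → Matrix (Fin n) (Fin m) ℝ) (Q : Fin N → Matrix (Fin n) (Fin n) ℝ)
    (R : Fin N → Matrix (Fin m) (Fin m) ℝ) :
    Matrix (Fin n ⊕ (Fin N × Fin n)) (Fin n ⊕ (Fin N × Fin n)) ℝ :=
  fromBlocks
    (A + ∑ j, inputWeight (B j) (R j) * (A⁻¹)ᵀ * Q j)
    (Matrix.of fun r q => -(inputWeight (B q.1) (R q.1) * (A⁻¹)ᵀ) r q.2)
    (Matrix.of fun q c => -((A⁻¹)ᵀ * Q q.1) q.2 c)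
    ((1 : Matrix (Fin N) (Fin N) ℝ) ⊗ₖ (A⁻¹)ᵀ)

/-- The image of the matrix `col(0, I_{Nn})`. -/
def costateSubspace (N n : ℕ) : Submodule ℝ (Fin n ⊕ (Fin N × Fin n) → ℝ) :=
  LinearMap.range (fromRows (0 : Matrix (Fin n) (Fin N × Fin n) ℝ)
    (1 : Matrix (Fin N × Fin n) (Fin N × Fin n) ℝ)).mulVecLin

/-- The image of the matrix `col(I_n, P₁, …, P_N)`. -/
def graphSubspace {N n : ℕ} (P : Fin N → Matrix (Fin n) (Fin n) ℝ) :
    Submodule ℝ (Fin n ⊕ (Fin N × Fin n) → ℝ) :=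
  LinearMap.range (fromRows (1 : Matrix (Fin n) (Fin n) ℝ)
    (Matrix.of fun (q : Fin N × Fin n) c => P q.1 q.2 c)).mulVecLin

/-- The spectral assumption on `H`: it has exactly `n` eigenvalues of modulus smaller than `1`,
and `V` is an `n`-dimensional stable invariant subspace of `H` complementary to the image of
`col(0, I_{Nn})`. -/
structure SpectralAssumption {N n : ℕ}
    (H : Matrix (Fin n ⊕ (Fin N × Fin n)) (Fin n ⊕ (Fin N × Fin n)) ℝ)
    (V : Submodule ℝ (Fin n ⊕ (Fin N × Fin n) → ℝ)) : Prop where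
  numStable : numStableEigenvalues H = n
  finrank_eq : Module.finrank ℝ V = n
  stable : IsStableInvariantSubspace H V
  isCompl : IsCompl V (costateSubspace N n)

/-- `(P, K)` is the solution of the algebraic Riccati equation that solves the standard LQR
problem for `(A, B)` with weights `Q`, `R`, i.e. the positive semidefinite one. -/
structure IsLQRSolution {n m : ℕ} (A : Matrix (Fin n) (Fin n) ℝ) (B : Matrix (Fin n) (Fin m) ℝ)
    (Q : Matrix (Fin n) (Fin n) ℝ) (R : Matrix (Fin m) (Fin m) ℝ)
    (P : Matrix (Fin n) (Fin n) ℝ) (K : Matrix (Fin m) (Fin n) ℝ) : Prop where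
  posSemidef : P.PosSemidef
  riccati : P = Q + Aᵀ * P * (A + B * K)
  gain : K = -(R⁻¹ * Bᵀ * P * (A + B * K))

/-- `Â i = [[A, ∑_{j ≠ i} B j K j], [0, A + ∑ j, B j K j]]`. -/
def augA {N n m : ℕ} (A : Matrix (Fin n) (Fin n) ℝ)
    (B : Fin N → Matrix (Fin n) (Fin m) ℝ) (K : Fin N → Matrix (Fin m) (Fin n) ℝ)
    (i : Fin N) : Matrix (Fin n ⊕ Fin n) (Fin n ⊕ Fin n) ℝ :=
  fromBlocks A (∑ j ∈ Finset.univ.erase i, B j * K j) 0 (closedLoop A B K)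

/-- `B̂ = [B; 0]`. -/
def augB {n m : ℕ} (B : Matrix (Fin n) (Fin m) ℝ) : Matrix (Fin n ⊕ Fin n) (Fin m) ℝ :=
  fromRows B 0

/-- `Q̂ = [[Q, 0], [0, 0]]`. -/
def augQ {n : ℕ} (Q : Matrix (Fin n) (Fin n) ℝ) : Matrix (Fin n ⊕ Fin n) (Fin n ⊕ Fin n) ℝ :=
  fromBlocks Q 0 0 0

/-- `(P, K)` is a positive semidefinite solution of the ARE
`P = Q + Aᵀ P (A + B K)`, `K = -(R + Bᵀ P B)⁻¹ Bᵀ P A`. -/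
structure IsPSDRiccatiSolution {κ μ : Type*} [Fintype κ] [Fintype μ] [DecidableEq μ]
    (A : Matrix κ κ ℝ) (B : Matrix κ μ ℝ) (Q : Matrix κ κ ℝ) (R : Matrix μ μ ℝ)
    (P : Matrix κ κ ℝ) (K : Matrix μ κ ℝ) : Prop where
  posSemidef : P.PosSemidef
  riccati : P = Q + Aᵀ * P * (A + B * K)
  gain : K = -((R + Bᵀ * P * B)⁻¹ * Bᵀ * P * A)

end

/-! Under the feedback `[K^LQR, K^OL - K^LQR]` the augmented closed loop is block upper triangular
with diagonal blocks `A + B_i K_i^LQR` and `Ā^OL`. The first is Schur by detectability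
(`isSchur_of_riccati`). The second is Schur because `H` restricted to the graph of `P^OL` is
conjugate to it (`isSchur_closedLoop`). The Lyapunov equation with this gain therefore has a
positive semidefinite solution `P̂`.

A Stein equation `Z = Fᵀ Z G` with Schur `F`, `G` forces `Z = 0` (`IsSchur.eq_zero_of_stein`).
Applied blockwise, this identifies the first block row of `P̂` as `[P^LQR, P^OL - P^LQR]`
(`augmented_blocks`). Only that row enters `B̂ᵀ P̂`, so the gain equation for `P̂` reduces to those
of the LQR and open-loop problems, and the Lyapunov equation becomes the Riccati equation.

For uniqueness, every positive semidefinite solution is stabilizing, since the augmented system has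
no unobservable unstable mode; the difference of two stabilizing solutions solves a Stein equation
(`riccati_unique`). -/

/-! ### Powers of Schur matrices; Stein and Lyapunov equations. -/

section Powers

variable {κ ι : Type*} [Fintype κ] [DecidableEq κ] [Fintype ι] [DecidableEq ι]

theorem isSchur_iff_spectrum (M : Matrix κ κ ℝ) :
    IsSchur M ↔ ∀ z ∈ spectrum ℂ (M.map (algebraMap ℝ ℂ)), ‖z‖ < 1 := by
  simp only [IsSchur, Matrix.mem_spectrum_iff_isRoot_charpoly,
    Polynomial.mem_roots (Matrix.charpoly_monic _).ne_zero]

theorem isSchur_iff_eigenvector (M : Matrix κ κ ℝ) :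
    IsSchur M ↔ ∀ (z : ℂ) (v : κ → ℂ), v ≠ 0 → M.map (algebraMap ℝ ℂ) *ᵥ v = z • v → ‖z‖ < 1 := by
  rw [isSchur_iff_spectrum]
  have key : ∀ z : ℂ, z ∈ spectrum ℂ (M.map (algebraMap ℝ ℂ)) ↔
      ∃ v : κ → ℂ, v ≠ 0 ∧ M.map (algebraMap ℝ ℂ) *ᵥ v = z • v := by
    intro z
    rw [spectrum.mem_iff, Matrix.isUnit_iff_isUnit_det, isUnit_iff_ne_zero, not_not,
      ← Matrix.exists_mulVec_eq_zero_iff]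
    simp only [Matrix.sub_mulVec, sub_eq_zero, Algebra.algebraMap_eq_smul_one, Matrix.smul_mulVec,
      Matrix.one_mulVec, eq_comm]
  simp only [key]
  exact ⟨fun h z v hv hz => h z ⟨v, hv, hz⟩, fun h z ⟨v, hv, hz⟩ => h z v hv hz⟩

open Filter Topology in
/-- In a complex Banach algebra, powers of an element whose spectrum lies in the open unit disc
tend to zero. -/
theorem tendsto_pow_zero_of_spectrum {𝔸 : Type*} [NormedRing 𝔸] [NormedAlgebra ℂ 𝔸]
    [CompleteSpace 𝔸] (a : 𝔸) (h : ∀ z ∈ spectrum ℂ a, ‖z‖ < 1) :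
    Tendsto (fun k => a ^ k) atTop (𝓝 0) := by
  nontriviality 𝔸
  -- The spectrum is compact, so the bound is strict for its supremum; Gelfand's formula then gives
  -- geometric decay.
  have h1 : spectralRadius ℂ a < (1 : NNReal) :=
    spectrum.spectralRadius_lt_of_forall_lt a fun z hz => by exact_mod_cast h z hz
  obtain ⟨r, hr, hr1⟩ := ENNReal.lt_iff_exists_nnreal_btwn.mp h1
  have hr1' : r < 1 := by exact_mod_cast hr1
  have h2 := (spectrum.pow_nnnorm_pow_one_div_tendsto_nhds_spectralRadius a).eventually
    (gt_mem_nhds hr)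
  rw [tendsto_zero_iff_norm_tendsto_zero]
  refine squeeze_zero' (Eventually.of_forall fun _ => norm_nonneg _) ?_
    (tendsto_pow_atTop_nhds_zero_of_lt_one r.coe_nonneg (by exact_mod_cast hr1'))
  filter_upwards [h2, eventually_gt_atTop 0] with k hk hk0
  have hk0' : (0 : ℝ) < k := by exact_mod_cast hk0
  have h3 := ENNReal.rpow_le_rpow hk.le hk0'.le
  rw [← ENNReal.rpow_mul, one_div_mul_cancel hk0'.ne', ENNReal.rpow_one, ENNReal.rpow_natCast] at h3
  exact_mod_cast h3

open Filter Topology in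
theorem IsSchur.tendsto_pow {M : Matrix κ κ ℝ} (h : IsSchur M) :
    Tendsto (fun k => M ^ k) atTop (𝓝 0) := by
  have hc : Tendsto (fun k => (M.map (algebraMap ℝ ℂ)) ^ k) atTop (𝓝 0) := by
    -- Any Banach algebra norm inducing the entrywise topology would do.
    let := Matrix.linftyOpNormedRing (n := κ) (α := ℂ)
    let := Matrix.linftyOpNormedAlgebra (n := κ) (R := ℂ) (α := ℂ)
    exact tendsto_pow_zero_of_spectrum _ ((isSchur_iff_spectrum M).mp h)
  have hre : Continuous fun X : Matrix κ κ ℂ => X.map Complex.re :=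
    continuous_id.matrix_map Complex.continuous_re
  have := (hre.tendsto 0).comp hc
  convert this using 1
  · funext k
    have : (M.map (algebraMap ℝ ℂ)) ^ k = (M ^ k).map (algebraMap ℝ ℂ) :=
      (Matrix.map_pow M (algebraMap ℝ ℂ) k).symm
    ext i j
    simp only [Function.comp_apply, this]
    simp
  · simp

open Filter Topology in
/-- The Stein equation `Z = Fᵀ Z G` with Schur matrices `F`, `G` has only the zero solution. -/
theorem IsSchur.eq_zero_of_stein {F : Matrix κ κ ℝ} {G : Matrix ι ι ℝ} (hF : IsSchur F)
    (hG : IsSchur G) {Z : Matrix κ ι ℝ} (h : Z = Fᵀ * Z * G) : Z = 0 := by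
  have hk : ∀ k : ℕ, Z = (F ^ k)ᵀ * Z * G ^ k := by
    intro k
    induction k with
    | zero => simp
    | succ k ih =>
      calc Z = (F ^ k)ᵀ * Z * G ^ k := ih
        _ = (F ^ k)ᵀ * (Fᵀ * Z * G) * G ^ k := by rw [← h]
        _ = _ := by
          simp only [pow_succ' F, pow_succ' G, Matrix.transpose_mul, Matrix.mul_assoc]
  have hc : Continuous fun X : Matrix κ κ ℝ × Matrix ι ι ℝ => X.1ᵀ * Z * X.2 := by fun_prop
  have := (hc.tendsto (0, 0)).comp (hF.tendsto_pow.prodMk_nhds hG.tendsto_pow)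
  refine tendsto_nhds_unique (tendsto_const_nhds (x := Z) (f := (atTop : Filter ℕ))) ?_
  convert this using 1
  · funext k; exact hk k
  · simp

open Filter Topology in
/-- A matrix satisfying a discrete Lyapunov inequality with Schur state matrix is positive
semidefinite. -/
theorem IsSchur.posSemidef_of_lyapunov {F W P : Matrix κ κ ℝ} (hF : IsSchur F)
    (hW : W.PosSemidef) (h : P = W + Fᵀ * P * F) : P.PosSemidef := by
  -- `Pᵀ` solves the same equation, so `P` is symmetric by uniqueness.
  have hsymm : Pᵀ = P := by
    have hWt : Wᵀ = W := hW.isHermitian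
    have h' : Pᵀ = W + Fᵀ * Pᵀ * F := by
      conv_lhs => rw [h]
      simp [Matrix.mul_assoc, hWt]
    rw [← sub_eq_zero]
    refine hF.eq_zero_of_stein hF ?_
    rw [Matrix.mul_sub, Matrix.sub_mul]
    exact (congrArg₂ (· - ·) h' h).trans (add_sub_add_left_eq_sub _ _ _)
  refine .of_dotProduct_mulVec_nonneg hsymm fun x => ?_
  have hstep : ∀ y : κ → ℝ, (F *ᵥ y) ⬝ᵥ P *ᵥ (F *ᵥ y) ≤ y ⬝ᵥ P *ᵥ y := by
    intro y
    have h0 := hW.dotProduct_mulVec_nonneg y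
    have : y ⬝ᵥ P *ᵥ y = y ⬝ᵥ W *ᵥ y + (F *ᵥ y) ⬝ᵥ P *ᵥ (F *ᵥ y) := by
      conv_lhs => rw [h]
      rw [Matrix.add_mulVec, dotProduct_add, ← Matrix.mulVec_mulVec, ← Matrix.mulVec_mulVec,
        Matrix.mulVec_transpose, dotProduct_comm y (_ ᵥ* F), ← Matrix.dotProduct_mulVec,
        dotProduct_comm (P *ᵥ _)]
    simp only [star_trivial] at h0
    linarith
  -- The quadratic form decreases along the trajectory `F ^ k x`, where it tends to `0`.
  have hk : ∀ k : ℕ, (F ^ k *ᵥ x) ⬝ᵥ P *ᵥ (F ^ k *ᵥ x) ≤ x ⬝ᵥ P *ᵥ x := by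
    intro k
    induction k with
    | zero => simp
    | succ k ih =>
      refine le_trans ?_ ih
      rw [pow_succ', ← Matrix.mulVec_mulVec]
      exact hstep _
  have hc : Continuous fun X : Matrix κ κ ℝ => (X *ᵥ x) ⬝ᵥ P *ᵥ (X *ᵥ x) := by fun_prop
  have := (hc.tendsto 0).comp hF.tendsto_pow
  simp only [Matrix.zero_mulVec, zero_dotProduct] at this
  simpa using le_of_tendsto' this hk

/-- The Lyapunov equation with Schur state matrix is solvable. -/
theorem IsSchur.exists_lyapunov {F : Matrix κ κ ℝ} (hF : IsSchur F) (W : Matrix κ κ ℝ) :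
    ∃ P, P = W + Fᵀ * P * F := by
  let T : Matrix κ κ ℝ →ₗ[ℝ] Matrix κ κ ℝ :=
    LinearMap.id - (LinearMap.mulLeft ℝ Fᵀ ∘ₗ LinearMap.mulRight ℝ F)
  have hT : ∀ P, T P = P - Fᵀ * P * F := fun P => by simp [T, Matrix.mul_assoc]
  have hinj : Function.Injective T := by
    rw [← LinearMap.ker_eq_bot, LinearMap.ker_eq_bot']
    intro Z hZ
    exact hF.eq_zero_of_stein hF (sub_eq_zero.mp (hT Z ▸ hZ))
  obtain ⟨P, hP⟩ := LinearMap.injective_iff_surjective.mp hinj W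
  exact ⟨P, by rw [← hP, hT]; abel⟩

end Powers

/-! ### Stability from Lyapunov equations and observability. -/

section Observability

variable {κ μ ν : Type*} [Fintype κ] [DecidableEq κ] [Fintype μ] [DecidableEq μ] [Fintype ν]

omit [DecidableEq κ] in
theorem star_dotProduct_map_gram_mulVec (M : Matrix ν κ ℝ) (v : κ → ℂ) :
    star v ⬝ᵥ (Mᵀ * M).map (algebraMap ℝ ℂ) *ᵥ v =
      ((∑ i, ‖(M.map (algebraMap ℝ ℂ) *ᵥ v) i‖ ^ 2 : ℝ) : ℂ) := by
  have h : (Mᵀ * M).map (algebraMap ℝ ℂ) =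
      (M.map (algebraMap ℝ ℂ))ᴴ * M.map (algebraMap ℝ ℂ) := by
    rw [Matrix.map_mul]
    congr 1
    ext i j
    simp
  rw [h, ← Matrix.mulVec_mulVec, Matrix.dotProduct_mulVec, ← Matrix.star_mulVec]
  simp [dotProduct, Complex.conj_mul']

theorem sum_sq_norm_nonneg {τ : Type*} [Fintype τ] (w : τ → ℂ) : 0 ≤ ∑ i, ‖w i‖ ^ 2 :=
  Finset.sum_nonneg fun _ _ => by positivity

theorem eq_zero_of_sum_sq_norm_eq_zero {τ : Type*} [Fintype τ] {w : τ → ℂ}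
    (h : ∑ i, ‖w i‖ ^ 2 = 0) : w = 0 := by
  funext i
  have := (Finset.sum_eq_zero_iff_of_nonneg (fun _ _ => by positivity)).mp h i (Finset.mem_univ i)
  simpa using this

theorem Matrix.PosSemidef.exists_transpose_mul_self {P : Matrix κ κ ℝ} (hP : P.PosSemidef) :
    ∃ L : Matrix κ κ ℝ, P = Lᵀ * L := by
  open scoped MatrixOrder in
  obtain ⟨L, hL⟩ := CStarAlgebra.nonneg_iff_eq_star_mul_self.mp hP.nonneg
  exact ⟨L, hL⟩

/-- If a Lyapunov equation has a positive semidefinite solution and no unstable mode is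
unobservable through `(C, K)`, the state matrix is Schur. -/
theorem isSchur_of_lyapunov {P F : Matrix κ κ ℝ} {K : Matrix μ κ ℝ} {C : Matrix ν κ ℝ}
    {R : Matrix μ μ ℝ} (hP : P.PosSemidef) (hR : R.PosDef)
    (h : P = Cᵀ * C + Kᵀ * R * K + Fᵀ * P * F)
    (hobs : ∀ (z : ℂ) (v : κ → ℂ), 1 ≤ ‖z‖ → F.map (algebraMap ℝ ℂ) *ᵥ v = z • v →
      K.map (algebraMap ℝ ℂ) *ᵥ v = 0 → C.map (algebraMap ℝ ℂ) *ᵥ v = 0 → v = 0) :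
    IsSchur F := by
  rw [isSchur_iff_eigenvector]
  intro z v hv hz
  by_contra! hz1
  refine hv ?_
  -- With `P = Lᵀ L` and `R = Sᵀ S`, an eigenvector `v` satisfies `|Lv|² = |Cv|² + |SKv|² + |z|²
  -- |Lv|²`. If `|z| ≥ 1`, both `Cv` and `SKv` vanish.
  obtain ⟨L, rfl⟩ := hP.exists_transpose_mul_self
  obtain ⟨S, rfl⟩ := hR.posSemidef.exists_transpose_mul_self
  have hS : IsUnit S := by
    have := hR.isUnit
    rw [Matrix.isUnit_iff_isUnit_det, Matrix.det_mul] at this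
    exact (Matrix.isUnit_iff_isUnit_det _).mpr (isUnit_of_mul_isUnit_right this)
  have h' : Lᵀ * L = Cᵀ * C + (S * K)ᵀ * (S * K) + (L * F)ᵀ * (L * F) := by
    rw [h]; simp only [Matrix.transpose_mul, Matrix.mul_assoc]
  have hq := congrArg (fun X => star v ⬝ᵥ X.map (algebraMap ℝ ℂ) *ᵥ v) h'
  simp only [Matrix.map_add _ (map_add (algebraMap ℝ ℂ)), Matrix.add_mulVec, dotProduct_add,
    star_dotProduct_map_gram_mulVec] at hq
  have hLF : (L * F).map (algebraMap ℝ ℂ) *ᵥ v = z • (L.map (algebraMap ℝ ℂ) *ᵥ v) := by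
    rw [Matrix.map_mul, ← Matrix.mulVec_mulVec, hz, Matrix.mulVec_smul]
  rw [hLF] at hq
  norm_cast at hq
  simp only [Pi.smul_apply, norm_smul, mul_pow, ← Finset.mul_sum] at hq
  have hL0 := sum_sq_norm_nonneg (L.map (algebraMap ℝ ℂ) *ᵥ v)
  have hC0 := sum_sq_norm_nonneg (C.map (algebraMap ℝ ℂ) *ᵥ v)
  have hK0 := sum_sq_norm_nonneg ((S * K).map (algebraMap ℝ ℂ) *ᵥ v)
  have hz2 : 1 ≤ ‖z‖ ^ 2 := one_le_pow₀ hz1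
  have hle := mul_le_mul_of_nonneg_right hz2 hL0
  have hC1 := eq_zero_of_sum_sq_norm_eq_zero (le_antisymm (by linarith) hC0)
  have hK1 := eq_zero_of_sum_sq_norm_eq_zero (le_antisymm (by linarith) hK0)
  refine hobs z v hz1 hz ?_ hC1
  have hS' : IsUnit (S.map (algebraMap ℝ ℂ)) := hS.map (algebraMap ℝ ℂ).mapMatrix
  rw [Matrix.map_mul, ← Matrix.mulVec_mulVec] at hK1
  exact Matrix.mulVec_injective_of_isUnit hS' (hK1.trans (Matrix.mulVec_zero _).symm)

end Observability

/-! ### Riccati equations with the gain in implicit form. -/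

section Riccati

variable {κ μ ν : Type*} [Fintype κ] [DecidableEq κ] [Fintype μ] [DecidableEq μ] [Fintype ν]
  {A : Matrix κ κ ℝ} {B : Matrix κ μ ℝ} {Q P P₁ P₂ : Matrix κ κ ℝ} {R : Matrix μ μ ℝ}
  {K K₁ K₂ : Matrix μ κ ℝ} {C : Matrix ν κ ℝ}

theorem weight_mul_eq_neg_of_gain {ι : Type*} (hR : R.PosDef) {K X : Matrix μ ι ℝ}
    (h : K = -(R⁻¹ * X)) : R * K = -X := by
  have hu : IsUnit R.det := (Matrix.isUnit_iff_isUnit_det R).mp hR.isUnit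
  rw [h, Matrix.mul_neg, Matrix.mul_nonsing_inv_cancel_left _ _ hu]

omit [DecidableEq κ] in
/-- The explicit and the implicit form of the feedback gain agree. -/
theorem gain_iff (hR : R.PosDef) (hP : P.PosSemidef) :
    K = -((R + Bᵀ * P * B)⁻¹ * Bᵀ * P * A) ↔ R * K = -(Bᵀ * P * (A + B * K)) := by
  have hpd : (R + Bᵀ * P * B).PosDef := by
    refine hR.add_posSemidef ?_
    simpa using hP.conjTranspose_mul_mul_same B
  have hu : IsUnit (R + Bᵀ * P * B).det := (Matrix.isUnit_iff_isUnit_det _).mp hpd.isUnit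
  have h1 : R * K = -(Bᵀ * P * (A + B * K)) ↔ (R + Bᵀ * P * B) * K = -(Bᵀ * P * A) := by
    rw [Matrix.mul_add, Matrix.add_mul, neg_add, ← Matrix.mul_assoc, ← sub_eq_add_neg,
      eq_sub_iff_add_eq]
  rw [h1, Matrix.mul_assoc, Matrix.mul_assoc, ← Matrix.mul_assoc Bᵀ]
  constructor
  · exact weight_mul_eq_neg_of_gain hpd
  · intro h
    rw [← Matrix.mul_neg, ← h, Matrix.nonsing_inv_mul_cancel_left _ _ hu]

-- Expanding only the left factor `(A + B K)ᵀ` leaves the extra term `Kᵀ Bᵀ P (A + B K)`, which the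
-- gain equation turns into `-Kᵀ R K`.
omit [DecidableEq κ] [DecidableEq μ] in
theorem lyapunov_of_riccati (hP : P = Q + Aᵀ * P * (A + B * K))
    (hK : R * K = -(Bᵀ * P * (A + B * K))) :
    P = Q + Kᵀ * R * K + (A + B * K)ᵀ * P * (A + B * K) := by
  have h1 : (A + B * K)ᵀ * P * (A + B * K) = Aᵀ * P * (A + B * K) + Kᵀ * (Bᵀ * P * (A + B * K)) := by
    simp only [Matrix.transpose_add, Matrix.transpose_mul, Matrix.add_mul, Matrix.mul_assoc]
  rw [h1, Matrix.mul_assoc Kᵀ, hK, Matrix.mul_neg]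
  nth_rw 1 [hP]
  abel

omit [DecidableEq κ] [DecidableEq μ] in
theorem riccati_of_lyapunov (hP : P = Q + Kᵀ * R * K + (A + B * K)ᵀ * P * (A + B * K))
    (hK : R * K = -(Bᵀ * P * (A + B * K))) : P = Q + Aᵀ * P * (A + B * K) := by
  have h1 : (A + B * K)ᵀ * P * (A + B * K) = Aᵀ * P * (A + B * K) + Kᵀ * (Bᵀ * P * (A + B * K)) := by
    simp only [Matrix.transpose_add, Matrix.transpose_mul, Matrix.add_mul, Matrix.mul_assoc]
  rw [h1, Matrix.mul_assoc Kᵀ, hK, Matrix.mul_neg] at hP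
  nth_rw 1 [hP]
  abel

/-- A positive semidefinite solution of the Riccati equation is stabilizing if `(A, C)` has no
unobservable unstable mode. -/
theorem isSchur_of_riccati (hPsd : P.PosSemidef) (hR : R.PosDef)
    (hP : P = Cᵀ * C + Aᵀ * P * (A + B * K)) (hK : R * K = -(Bᵀ * P * (A + B * K)))
    (hobs : ∀ (z : ℂ) (v : κ → ℂ), 1 ≤ ‖z‖ → A.map (algebraMap ℝ ℂ) *ᵥ v = z • v →
      C.map (algebraMap ℝ ℂ) *ᵥ v = 0 → v = 0) : IsSchur (A + B * K) := by
  refine isSchur_of_lyapunov hPsd hR (lyapunov_of_riccati hP hK) fun z v hz hv hKv hCv => ?_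
  refine hobs z v hz ?_ hCv
  rwa [Matrix.map_add _ (map_add (algebraMap ℝ ℂ)), Matrix.map_mul, Matrix.add_mulVec,
    ← Matrix.mulVec_mulVec, hKv, Matrix.mulVec_zero, add_zero] at hv

omit [DecidableEq μ] in
/-- The stabilizing symmetric solution of the Riccati equation is unique. -/
theorem riccati_unique (hRs : Rᵀ = R) (hs : P₁ᵀ = P₁)
    (hP₁ : P₁ = Q + Aᵀ * P₁ * (A + B * K₁)) (hK₁ : R * K₁ = -(Bᵀ * P₁ * (A + B * K₁)))
    (hP₂ : P₂ = Q + Aᵀ * P₂ * (A + B * K₂)) (hK₂ : R * K₂ = -(Bᵀ * P₂ * (A + B * K₂)))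
    (hQ : Qᵀ = Q) (h₁ : IsSchur (A + B * K₁)) (h₂ : IsSchur (A + B * K₂)) : P₁ = P₂ := by
  -- The gain on the left may be arbitrary, because only the gain equation of `K` is used. Crossing
  -- the two gains and transposing one identity gives both solutions the same inhomogeneous term `Q
  -- + K₁ᵀ R K₂`.
  have mixed : ∀ {P : Matrix κ κ ℝ} {K K' : Matrix μ κ ℝ}, P = Q + Aᵀ * P * (A + B * K) →
      R * K = -(Bᵀ * P * (A + B * K)) →
      P = Q + K'ᵀ * R * K + (A + B * K')ᵀ * P * (A + B * K) := by
    intro P K K' hP hK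
    have h1 : (A + B * K')ᵀ * P * (A + B * K) =
        Aᵀ * P * (A + B * K) + K'ᵀ * (Bᵀ * P * (A + B * K)) := by
      simp only [Matrix.transpose_add, Matrix.transpose_mul, Matrix.add_mul, Matrix.mul_assoc]
    rw [h1, Matrix.mul_assoc K'ᵀ, hK, Matrix.mul_neg]
    nth_rw 1 [hP]
    abel
  have e₁ := mixed (K' := K₂) hP₁ hK₁
  have e₂ := mixed (K' := K₁) hP₂ hK₂
  have e₁' : P₁ = Q + K₁ᵀ * R * K₂ + (A + B * K₁)ᵀ * P₁ * (A + B * K₂) := by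
    have := congrArg Matrix.transpose e₁
    simpa only [hs, Matrix.transpose_add, Matrix.transpose_mul, Matrix.transpose_transpose, hQ, hRs,
      Matrix.mul_assoc] using this
  rw [← sub_eq_zero]
  refine h₁.eq_zero_of_stein h₂ ?_
  rw [Matrix.mul_sub, Matrix.sub_mul]
  exact (congrArg₂ (· - ·) e₁' e₂).trans (add_sub_add_left_eq_sub _ _ _)

end Riccati

/-! ### Detectability and block triangular matrices. -/

/-- An unobservable mode is untouched by output injection: `(A + L C) v = A v` for every `L`. -/
theorem IsDetectable.eq_zero_of_eigenvector {n p : ℕ} {A : Matrix (Fin n) (Fin n) ℝ}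
    {C : Matrix (Fin p) (Fin n) ℝ} (h : IsDetectable A C) {z : ℂ} {v : Fin n → ℂ} (hz : 1 ≤ ‖z‖)
    (hA : A.map (algebraMap ℝ ℂ) *ᵥ v = z • v) (hC : C.map (algebraMap ℝ ℂ) *ᵥ v = 0) : v = 0 := by
  obtain ⟨L, hL⟩ := h
  by_contra hv
  refine hz.not_gt ((isSchur_iff_eigenvector _).mp hL z v hv ?_)
  rw [Matrix.map_add _ (map_add (algebraMap ℝ ℂ)), Matrix.map_mul, Matrix.add_mulVec,
    ← Matrix.mulVec_mulVec, hC, Matrix.mulVec_zero, add_zero, hA]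

theorem IsSchur.fromBlocks_zero₂₁ {κ ι : Type*} [Fintype κ] [DecidableEq κ] [Fintype ι]
    [DecidableEq ι] {F : Matrix κ κ ℝ} {G : Matrix ι ι ℝ} (hF : IsSchur F) (hG : IsSchur G)
    (D : Matrix κ ι ℝ) : IsSchur (fromBlocks F D 0 G) := by
  intro z hz
  rw [Matrix.fromBlocks_map, Matrix.map_zero _ (map_zero _), Matrix.charpoly_fromBlocks_zero₂₁,
    Polynomial.roots_mul ((Matrix.charpoly_monic _).mul (Matrix.charpoly_monic _)).ne_zero,
    Multiset.mem_add] at hz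
  exact hz.elim (hF z) (hG z)

/-! ### The stable graph subspace of `H` and the open-loop closed loop. -/

section OpenLoop

variable {N n m : ℕ} {A : Matrix (Fin n) (Fin n) ℝ} {B : Fin N → Matrix (Fin n) (Fin m) ℝ}
  {Q : Fin N → Matrix (Fin n) (Fin n) ℝ} {R : Fin N → Matrix (Fin m) (Fin m) ℝ}
  {P : Fin N → Matrix (Fin n) (Fin n) ℝ} {K : Fin N → Matrix (Fin m) (Fin n) ℝ}

/-- `col(I, P₁, …, P_N)`. -/
def graphMatrix (P : Fin N → Matrix (Fin n) (Fin n) ℝ) :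
    Matrix (Fin n ⊕ (Fin N × Fin n)) (Fin n) ℝ :=
  fromRows 1 (Matrix.of fun (q : Fin N × Fin n) c => P q.1 q.2 c)

/-- The Riccati equations give `A⁻ᵀ (P_j - Q_j) = P_j Ā`, which settles the costate rows;
multiplying by `S_j` gives `-B_j K_j`, which settles the state row. -/
theorem openLoopMatrix_mul_graphMatrix (hA : IsUnit A) (h : SolvesOpenLoopRiccati A B Q R P K) :
    openLoopMatrix A B Q R * graphMatrix P = graphMatrix P * closedLoop A B K := by
  have hAT : (A⁻¹)ᵀ * Aᵀ = 1 := by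
    rw [← Matrix.transpose_mul, Matrix.mul_nonsing_inv _ ((Matrix.isUnit_iff_isUnit_det A).mp hA),
      Matrix.transpose_one]
  have hcost : ∀ j, (A⁻¹)ᵀ * (P j - Q j) = P j * closedLoop A B K := by
    intro j
    nth_rw 1 [(h j).1]
    rw [add_sub_cancel_left, ← Matrix.mul_assoc, ← Matrix.mul_assoc, hAT, Matrix.one_mul]
  have hin : ∀ j, inputWeight (B j) (R j) * (A⁻¹)ᵀ * (P j - Q j) = -(B j * K j) := by
    intro j
    rw [Matrix.mul_assoc, hcost, (h j).2]
    simp only [inputWeight, Matrix.mul_neg, neg_neg, Matrix.mul_assoc]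
  have hrow : (Matrix.of fun (r : Fin n) (q : Fin N × Fin n) =>
        -(inputWeight (B q.1) (R q.1) * (A⁻¹)ᵀ) r q.2) *
      (Matrix.of fun (q : Fin N × Fin n) c => P q.1 q.2 c) =
      -∑ j, inputWeight (B j) (R j) * (A⁻¹)ᵀ * P j := by
    ext r c
    simp only [Matrix.mul_apply, Fintype.sum_prod_type, Matrix.of_apply, Matrix.neg_apply,
      Matrix.sum_apply, neg_mul, Finset.sum_neg_distrib]
  have hkron : ((1 : Matrix (Fin N) (Fin N) ℝ) ⊗ₖ (A⁻¹)ᵀ) *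
      (Matrix.of fun (q : Fin N × Fin n) c => P q.1 q.2 c) =
      Matrix.of fun (q : Fin N × Fin n) c => ((A⁻¹)ᵀ * P q.1) q.2 c := by
    ext ⟨j, r⟩ c
    simp [Matrix.mul_apply, Fintype.sum_prod_type, Matrix.one_apply, ite_mul, Finset.sum_ite_eq]
  rw [openLoopMatrix, graphMatrix, Matrix.fromBlocks_mul_fromRows, Matrix.fromRows_mul, hrow, hkron,
    Matrix.mul_one, Matrix.mul_one, Matrix.one_mul]
  congr 1
  · have : ∑ j, inputWeight (B j) (R j) * (A⁻¹)ᵀ * P j =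
        ∑ j, inputWeight (B j) (R j) * (A⁻¹)ᵀ * Q j - ∑ j, B j * K j := by
      rw [← Finset.sum_sub_distrib]
      refine Finset.sum_congr rfl fun j _ => ?_
      have := hin j
      rw [Matrix.mul_sub, sub_eq_iff_eq_add] at this
      rw [this]; abel
    rw [this, closedLoop]; abel
  · ext ⟨j, r⟩ c
    have h1 := congrFun (congrFun (hcost j) r) c
    rw [Matrix.mul_sub, Matrix.sub_apply] at h1
    change -((A⁻¹)ᵀ * Q j) r c + ((A⁻¹)ᵀ * P j) r c = (P j * closedLoop A B K) r c
    rw [← h1]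
    ring

/-- The injective map `col(I, P₁, …, P_N)` conjugates the closed loop to `H` restricted to the
graph, so the characteristic polynomials agree. -/
theorem isSchur_closedLoop (hA : IsUnit A) (h : SolvesOpenLoopRiccati A B Q R P K)
    (hV : IsStableInvariantSubspace (openLoopMatrix A B Q R) (graphSubspace P)) :
    IsSchur (closedLoop A B K) := by
  obtain ⟨hinv, hst⟩ := hV
  have hinj : Function.Injective (graphMatrix P).mulVecLin := by
    intro x y hxy
    have := congrArg (fun w : Fin n ⊕ (Fin N × Fin n) → ℝ => w ∘ Sum.inl) hxy
    simpa [graphMatrix, Matrix.fromRows_mulVec] using this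
  let e : (Fin n → ℝ) ≃ₗ[ℝ] graphSubspace P := LinearEquiv.ofInjective _ hinj
  have hconj : (openLoopMatrix A B Q R).mulVecLin.restrict hinv =
      e.conj (closedLoop A B K).mulVecLin := by
    refine LinearMap.ext fun y => ?_
    obtain ⟨x, rfl⟩ := e.surjective y
    rw [LinearEquiv.conj_apply_apply, LinearEquiv.symm_apply_apply]
    apply Subtype.ext
    change openLoopMatrix A B Q R *ᵥ (graphMatrix P *ᵥ x) =
      graphMatrix P *ᵥ (closedLoop A B K *ᵥ x)
    rw [Matrix.mulVec_mulVec, Matrix.mulVec_mulVec, openLoopMatrix_mul_graphMatrix hA h]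
  intro z hz
  refine hst z ?_
  rw [hconj, LinearEquiv.charpoly_conj, Matrix.charpoly_mulVecLin]
  rwa [Matrix.charpoly_map] at hz

end OpenLoop

/-! ### The augmented system. -/

section Augmented

variable {N n m : ℕ} {A : Matrix (Fin n) (Fin n) ℝ} {B : Fin N → Matrix (Fin n) (Fin m) ℝ}
  {K : Fin N → Matrix (Fin m) (Fin n) ℝ} {i : Fin N}

/-- The augmented closed loop under the feedback `[L, K i - L]`. -/
theorem augA_add_augB_mul (L : Matrix (Fin m) (Fin n) ℝ) :
    augA A B K i + augB (B i) * fromCols L (K i - L) =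
      fromBlocks (A + B i * L) (closedLoop A B K - (A + B i * L)) 0 (closedLoop A B K) := by
  have hsum : ∑ j ∈ Finset.univ.erase i, B j * K j + B i * K i = ∑ j, B j * K j :=
    Finset.sum_erase_add _ _ (Finset.mem_univ i)
  rw [augA, augB, Matrix.fromRows_mul_fromCols, Matrix.fromBlocks_add]
  congr 1
  · rw [Matrix.mul_sub, closedLoop, ← hsum]
    abel
  · simp
  · simp

/-- The augmented system has no unobservable unstable mode. -/
theorem augA_eq_zero_of_eigenvector {p : ℕ} {C : Matrix (Fin p) (Fin n) ℝ}
    (hdet : IsDetectable A C) (hcl : IsSchur (closedLoop A B K)) {z : ℂ} {v : Fin n ⊕ Fin n → ℂ}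
    (hz : 1 ≤ ‖z‖) (hv : (augA A B K i).map (algebraMap ℝ ℂ) *ᵥ v = z • v)
    (hC : (fromCols C (0 : Matrix (Fin p) (Fin n) ℝ)).map (algebraMap ℝ ℂ) *ᵥ v = 0) : v = 0 := by
  rw [augA, Matrix.fromBlocks_map, Matrix.fromBlocks_mulVec] at hv
  have h1 := congrArg (fun w : Fin n ⊕ Fin n → ℂ => w ∘ Sum.inl) hv
  have h2 := congrArg (fun w : Fin n ⊕ Fin n → ℂ => w ∘ Sum.inr) hv
  simp only [Sum.elim_comp_inl, Sum.elim_comp_inr, Matrix.map_zero _ (map_zero _),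
    Matrix.zero_mulVec, zero_add] at h1 h2
  rw [Matrix.fromCols_map, Matrix.map_zero _ (map_zero _), Matrix.fromCols_mulVec,
    Matrix.zero_mulVec, add_zero] at hC
  -- A nonzero lower part would be an unstable eigenvector of the Schur closed loop. Once it
  -- vanishes, the upper part is an unobservable mode of `(A, C)`.
  have hr : v ∘ Sum.inr = 0 := by
    by_contra hne
    exact hz.not_gt ((isSchur_iff_eigenvector _).mp hcl z _ hne h2)
  rw [hr, Matrix.mulVec_zero, add_zero] at h1
  have hl : v ∘ Sum.inl = 0 := hdet.eq_zero_of_eigenvector hz h1 hC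
  funext k
  rcases k with k | k
  · exact congrFun hl k
  · exact congrFun hr k

theorem augQ_eq_transpose_mul {p : ℕ} (C : Matrix (Fin p) (Fin n) ℝ) :
    augQ (Cᵀ * C) = (fromCols C (0 : Matrix (Fin p) (Fin n) ℝ))ᵀ * fromCols C 0 := by
  rw [augQ, Matrix.transpose_fromCols, Matrix.fromRows_mul_fromCols]
  simp

/-- The `(1,1)` and `(1,2)` blocks of a symmetric solution of the augmented Lyapunov equation. -/
theorem augmented_blocks {F G Q P₁ P₂ : Matrix (Fin n) (Fin n) ℝ} {R : Matrix (Fin m) (Fin m) ℝ}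
    {L L' : Matrix (Fin m) (Fin n) ℝ} {X Y Z W : Matrix (Fin n) (Fin n) ℝ} (hF : IsSchur F)
    (hG : IsSchur G) (h₁ : P₁ = Q + Lᵀ * R * L + Fᵀ * P₁ * F)
    (h₂ : P₂ = Q + Lᵀ * R * L' + Fᵀ * P₂ * G)
    (h : fromBlocks X Y Z W = augQ Q + (fromCols L (L' - L))ᵀ * R * fromCols L (L' - L) +
      (fromBlocks F (G - F) 0 G)ᵀ * fromBlocks X Y Z W * fromBlocks F (G - F) 0 G) :
    X = P₁ ∧ Y = P₂ - P₁ := by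
  rw [augQ, Matrix.transpose_fromCols, Matrix.fromRows_mul, Matrix.fromRows_mul_fromCols,
    Matrix.fromBlocks_transpose, Matrix.fromBlocks_multiply, Matrix.fromBlocks_multiply,
    Matrix.fromBlocks_add, Matrix.fromBlocks_add, Matrix.fromBlocks_inj] at h
  obtain ⟨hX, hY, -, -⟩ := h
  simp only [Matrix.transpose_zero, Matrix.zero_mul, Matrix.mul_zero, add_zero, zero_add] at hX hY
  have e₁ : X = P₁ := by
    rw [← sub_eq_zero]
    refine hF.eq_zero_of_stein hF ?_
    rw [Matrix.mul_sub, Matrix.sub_mul]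
    exact (congrArg₂ (· - ·) hX h₁).trans (add_sub_add_left_eq_sub _ _ _)
  refine ⟨e₁, ?_⟩
  subst e₁
  rw [← sub_eq_zero]
  refine hF.eq_zero_of_stein hG ?_
  -- `P₂ - X` satisfies the same (1,2)-block equation as `Y`, so their difference solves a Stein
  -- equation in `F`, `G`.
  have h₃ : P₂ - X = Lᵀ * R * (L' - L) + (Fᵀ * P₂ * G - Fᵀ * X * F) := by
    refine (congrArg₂ (· - ·) h₂ h₁).trans ?_
    rw [Matrix.mul_sub]
    abel
  refine (congrArg₂ (· - ·) hY h₃).trans ?_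
  simp only [Matrix.mul_sub, Matrix.sub_mul]
  abel

end Augmented

/-! ### The main theorem. -/

theorem mainTheorem3 {N n m : ℕ} {p : Fin N → ℕ}
    (A : Matrix (Fin n) (Fin n) ℝ)
    (B : Fin N → Matrix (Fin n) (Fin m) ℝ)
    (C : (i : Fin N) → Matrix (Fin (p i)) (Fin n) ℝ)
    (Q : Fin N → Matrix (Fin n) (Fin n) ℝ)
    (R : Fin N → Matrix (Fin m) (Fin m) ℝ)
    (hQ : ∀ i, Q i = (C i)ᵀ * C i)
    (hR : ∀ i, (R i).PosDef)
    (hA : IsUnit A)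
    (hstab : ∀ i, IsStabilizable A (B i))
    (hdet : ∀ i, IsDetectable A (C i))
    (V : Submodule ℝ (Fin n ⊕ (Fin N × Fin n) → ℝ))
    (hH : SpectralAssumption (openLoopMatrix A B Q R) V)
    (POL : Fin N → Matrix (Fin n) (Fin n) ℝ)
    (KOL : Fin N → Matrix (Fin m) (Fin n) ℝ)
    (hOL : SolvesOpenLoopRiccati A B Q R POL KOL)
    (hV : graphSubspace POL = V)
    (PLQR : Fin N → Matrix (Fin n) (Fin n) ℝ)
    (KLQR : Fin N → Matrix (Fin m) (Fin n) ℝ)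
    (hLQR : ∀ i, IsLQRSolution A (B i) (Q i) (R i) (PLQR i) (KLQR i))
    (i : Fin N) :
    ∃ (Phat : Matrix (Fin n ⊕ Fin n) (Fin n ⊕ Fin n) ℝ)
      (Khat : Matrix (Fin m) (Fin n ⊕ Fin n) ℝ),
      IsPSDRiccatiSolution (augA A B KOL i) (augB (B i)) (augQ (Q i)) (R i) Phat Khat ∧
      (∀ P' K', IsPSDRiccatiSolution (augA A B KOL i) (augB (B i)) (augQ (Q i)) (R i) P' K' →
        P' = Phat ∧ K' = Khat) ∧
      (∃ P₂₂ : Matrix (Fin n) (Fin n) ℝ,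
        Phat = Matrix.fromBlocks (PLQR i) (POL i - PLQR i) (POL i - PLQR i)ᵀ P₂₂) ∧
      Khat = Matrix.fromCols (KLQR i) (KOL i - KLQR i) ∧
      IsSchur (augA A B KOL i + augB (B i) * Khat) := by
  have hRi := hR i
  have hcl : IsSchur (closedLoop A B KOL) := by
    have := hH.stable
    rw [← hV] at this
    exact isSchur_closedLoop hA hOL this
  obtain ⟨hLpsd, hLric, hLgain⟩ := hLQR i
  obtain ⟨hOric, hOgain⟩ := hOL i
  have hLK : R i * KLQR i = -((B i)ᵀ * PLQR i * (A + B i * KLQR i)) :=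
    weight_mul_eq_neg_of_gain hRi (by simpa only [Matrix.mul_assoc] using hLgain)
  have hOK : R i * KOL i = -((B i)ᵀ * POL i * closedLoop A B KOL) :=
    weight_mul_eq_neg_of_gain hRi (by simpa only [Matrix.mul_assoc] using hOgain)
  have hF : IsSchur (A + B i * KLQR i) :=
    isSchur_of_riccati hLpsd hRi (by rw [← hQ i]; exact hLric) hLK
      fun z v hz hv hC => (hdet i).eq_zero_of_eigenvector hz hv hC
  have hRs : (R i)ᵀ = R i := hRi.isHermitian
  have hQs : (augQ (Q i))ᵀ = augQ (Q i) := by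
    rw [hQ i, augQ_eq_transpose_mul, Matrix.transpose_mul, Matrix.transpose_transpose]
  have hLlyap := lyapunov_of_riccati hLric hLK
  -- The open-loop equation is rewritten with the LQR closed loop on the left, matching the
  -- off-diagonal block of the augmented equation.
  have hOlyap : POL i = Q i + (KLQR i)ᵀ * R i * KOL i +
      (A + B i * KLQR i)ᵀ * POL i * closedLoop A B KOL := by
    have h1 : (A + B i * KLQR i)ᵀ * POL i * closedLoop A B KOL =
        Aᵀ * POL i * closedLoop A B KOL +
          (KLQR i)ᵀ * ((B i)ᵀ * POL i * closedLoop A B KOL) := by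
      simp only [Matrix.transpose_add, Matrix.transpose_mul, Matrix.add_mul, Matrix.mul_assoc]
    rw [h1, Matrix.mul_assoc _ (R i), hOK, Matrix.mul_neg]
    nth_rw 1 [hOric]
    abel
  have hAcl := augA_add_augB_mul (A := A) (B := B) (K := KOL) (i := i) (KLQR i)
  have hS : IsSchur (augA A B KOL i + augB (B i) * fromCols (KLQR i) (KOL i - KLQR i)) := by
    rw [hAcl]
    exact hF.fromBlocks_zero₂₁ hcl _
  obtain ⟨Phat, hPhat⟩ := hS.exists_lyapunov
    (augQ (Q i) + (fromCols (KLQR i) (KOL i - KLQR i))ᵀ * R i *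
      fromCols (KLQR i) (KOL i - KLQR i))
  have hpsd : Phat.PosSemidef := by
    refine hS.posSemidef_of_lyapunov (.add ?_ ?_) hPhat
    · rw [hQ i, augQ_eq_transpose_mul]
      exact Matrix.posSemidef_conjTranspose_mul_self _
    · exact hRi.posSemidef.conjTranspose_mul_mul_same _
  have hsymm : Phatᵀ = Phat := hpsd.isHermitian
  obtain ⟨h11, h12⟩ := augmented_blocks hF hcl hLlyap hOlyap
    (X := Phat.toBlocks₁₁) (Y := Phat.toBlocks₁₂) (Z := Phat.toBlocks₂₁) (W := Phat.toBlocks₂₂) (by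
      rw [Matrix.fromBlocks_toBlocks, ← hAcl]
      exact hPhat)
  have hform : Phat = fromBlocks (PLQR i) (POL i - PLQR i) (POL i - PLQR i)ᵀ Phat.toBlocks₂₂ := by
    have h21 : Phat.toBlocks₂₁ = (Phat.toBlocks₁₂)ᵀ := by
      nth_rw 1 [← hsymm]
      rfl
    rw [← h12, ← h11, ← h21, Matrix.fromBlocks_toBlocks]
  have hgain : R i * fromCols (KLQR i) (KOL i - KLQR i) =
      -((augB (B i))ᵀ * Phat * (augA A B KOL i + augB (B i) *
        fromCols (KLQR i) (KOL i - KLQR i))) := by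
    rw [hAcl, hform, augB, Matrix.transpose_fromRows, Matrix.fromCols_mul_fromBlocks,
      Matrix.fromCols_mul_fromBlocks, Matrix.mul_fromCols, Matrix.fromCols_neg, Matrix.mul_sub,
      hLK, hOK]
    simp only [Matrix.transpose_zero, Matrix.zero_mul, Matrix.mul_zero, add_zero]
    congr 1
    simp only [Matrix.mul_sub, Matrix.sub_mul]
    abel
  have hric := riccati_of_lyapunov hPhat hgain
  refine ⟨Phat, fromCols (KLQR i) (KOL i - KLQR i),
    ⟨hpsd, hric, (gain_iff hRi hpsd).mpr hgain⟩, ?_, ⟨_, hform⟩, rfl, hS⟩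
  rintro P' K' ⟨hpsd', hric', hgain'⟩
  have hK' := (gain_iff hRi hpsd').mp hgain'
  have hS' : IsSchur (augA A B KOL i + augB (B i) * K') :=
    isSchur_of_riccati hpsd' hRi (by rw [← augQ_eq_transpose_mul, ← hQ i]; exact hric') hK'
      fun z v hz hv hC => augA_eq_zero_of_eigenvector (hdet i) hcl hz hv hC
  have hP : P' = Phat :=
    riccati_unique hRs hpsd'.isHermitian hric' hK' hric hgain hQs hS' hS
  refine ⟨hP, ?_⟩
  rw [hgain', hP]
  exact ((gain_iff hRi hpsd).mpr hgain).symm
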